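/- Let $(S,+)$ be a commutative semigroup with neutral element $0$, let $E$ be a complex Banach space, and let $\mathscr{L}(E)$ be the algebra of bounded linear operators on $E$ with the operator norm. Let $T\colon S\to\mathscr{L}(E)$, $s\mapsto T_s$, be a bounded representation, i.e. $T_0=\mathrm{id}_E$, $T_{s+t}=T_sT_t$ for all $s,t\in S$, and $\sup_{s\in S}\|T_s\|<\infty$. Assume that $T$ is quasi-compact, i.e. there are $s\in S$ and a compact operator $K\in\mathscr{L}(E)$ with $\|T_s-K\|<1$. A unitary character of $S$ is a map $\chi\colon S\to\{z\in\mathbb{C} : |z|=1\}$ with $\chi(0)=1$ and $\chi(s+t)=\chi(s)\chi(t)$ for all $s,t\in S$. A bounded representation $R\colon S\to\mathscr{L}(E)$ is called uniformly mean ergodic if the operator norm closed convex hull $\mathcal{C}$ of $\{R_s : s\in S\}$ contains an element $P$ such that $AP=PA=P$ for every $A\in\mathcal{C}$. Then $T$ is totally uniformly mean ergodic, i.e. for every unitary character $\chi$ of $S$ the bounded representation $\chi T\colon s\mapsto\chi(s)T_s$ is uniformly mean ergodic. Moreover, for every unitary character $\chi$ of $S$ the eigenspace $$\ker(\chi-T)=\{x\in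 E : T_sx=\chi(s)x \text{ for every } s\in S\}$$ is finite-dimensional. -/

import Mathlib

noncomputable section

namespace SemigroupRep

variable (S : Type*) [AddCommMonoid S] (E : Type*) [NormedAddCommGroup E] [NormedSpace ℂ E]

/-- Representations of the additive commutative monoid `S` on `E`: monoid homomorphisms from `S`
(written multiplicatively) to the bounded operators on `E`, that is, `T (s + t) = T s * T t` and
`T 0 = 1`. -/
abbrev OperatorRep : Type _ := Multiplicative S →* (E →L[ℂ] E)

/-- Unitary characters of `S`: monoid homomorphisms from `S` to the complex unit circle. -/
abbrev UnitaryCharacter : Type _ := Multiplicative S →* Circle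

variable {S E}

/-- The operator `T_s` of a representation. -/
def op (T : OperatorRep S E) (s : S) : E →L[ℂ] E := T (Multiplicative.ofAdd s)

/-- The value `χ(s)`, as a complex number. -/
def UnitaryCharacter.val (χ : UnitaryCharacter S) (s : S) : ℂ :=
  (χ (Multiplicative.ofAdd s) : ℂ)

/-- The representation `χT`, given by `s ↦ χ(s) T_s`. -/
def rotate (χ : UnitaryCharacter S) (T : OperatorRep S E) : OperatorRep S E where
  toFun s := (χ s : ℂ) • T s
  map_one' := by simp
  map_mul' s t := by simp [smul_smul, mul_comm (χ s : ℂ)]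

/-- `T` is bounded: `sup_s ‖T_s‖ < ∞`. -/
def IsBounded (T : OperatorRep S E) : Prop :=
  ∃ C : ℝ, ∀ s : S, ‖op T s‖ ≤ C

/-- The operator norm closure of the convex hull of `{T_s | s ∈ S}`. -/
def closedConvexHullRange (T : OperatorRep S E) : Set (E →L[ℂ] E) :=
  closure (convexHull ℝ (Set.range (op T)))

/-- `T` is uniformly mean ergodic: `T` is bounded and the operator norm closed convex hull
of `{T_s | s ∈ S}` contains a zero element. -/
def IsUniformlyMeanErgodic (T : OperatorRep S E) : Prop :=
  IsBounded T ∧ ∃ P ∈ closedConvexHullRange T,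
    ∀ R ∈ closedConvexHullRange T, R * P = P ∧ P * R = P

/-- `T` is totally uniformly mean ergodic: `T` is bounded and `χT` is uniformly mean ergodic for
every unitary character `χ`. -/
def IsTotallyUniformlyMeanErgodic (T : OperatorRep S E) : Prop :=
  IsBounded T ∧ ∀ χ : UnitaryCharacter S, IsUniformlyMeanErgodic (rotate χ T)

/-- `T` is quasi-compact: some operator `T_s` has operator norm distance less than `1` from some
compact operator. -/
def IsQuasiCompact (T : OperatorRep S E) : Prop :=
  ∃ (s : S) (K : E →L[ℂ] E), IsCompactOperator K ∧ ‖op T s - K‖ < 1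

/-- The eigenspace `ker(χ - T) = ⋂_s ker(χ(s) - T_s)`. -/
def eigenspace (χ : UnitaryCharacter S) (T : OperatorRep S E) : Submodule ℂ E :=
  ⨅ s : S, LinearMap.ker ((χ.val s • (1 : E →L[ℂ] E) - op T s : E →L[ℂ] E) : E →ₗ[ℂ] E)

end SemigroupRep

end

open Filter Topology

namespace SemigroupRep

variable {S : Type*} [AddCommMonoid S] {E : Type*} [NormedAddCommGroup E] [NormedSpace ℂ E]

/-! Rotation by `χ` preserves boundedness and quasi-compactness, so it suffices to find a zero
element for a bounded quasi-compact `T`. The convex hull `H` of the operators is a commutative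
semigroup, so its translates `A H` have the finite intersection property and lie in a common
ultrafilter `U`. A limit `P` of `U` is fixed by each `T_s`, since Cesàro means `A` make `(1 - T_s)
A` small.

The limit exists by quasi-compactness (`cauchy_of_translates_mem`): with `Q = T_s` near a compact
`K`, `U` is an image under `R ↦ Q R Q`, which is uniformly close on `H` to `R ↦ K R K`, and the
latter is norm-Cauchy along ultrafilters on bounded sets. -/

theorem op_add (T : OperatorRep S E) (s t : S) : op T (s + t) = op T s * op T t := by
  simp [op, ofAdd_add]

theorem op_zero (T : OperatorRep S E) : op T 0 = 1 := by
  simp [op]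

theorem op_nsmul (T : OperatorRep S E) (n : ℕ) (s : S) : op T (n • s) = op T s ^ n := by
  simp [op, ofAdd_nsmul]

theorem op_rotate (χ : UnitaryCharacter S) (T : OperatorRep S E) (s : S) :
    op (rotate χ T) s = χ.val s • op T s := rfl

theorem UnitaryCharacter.norm_val (χ : UnitaryCharacter S) (s : S) : ‖χ.val s‖ = 1 :=
  Circle.norm_coe _

theorem IsBounded.rotate {T : OperatorRep S E} (h : IsBounded T) (χ : UnitaryCharacter S) :
    IsBounded (rotate χ T) := by
  obtain ⟨C, hC⟩ := h
  refine ⟨C, fun s => ?_⟩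
  rw [op_rotate, norm_smul, χ.norm_val, one_mul]
  exact hC s

theorem IsQuasiCompact.rotate {T : OperatorRep S E} (h : IsQuasiCompact T)
    (χ : UnitaryCharacter S) : IsQuasiCompact (rotate χ T) := by
  obtain ⟨s, K, hK, hlt⟩ := h
  refine ⟨s, χ.val s • K, hK.smul _, ?_⟩
  rwa [op_rotate, ← smul_sub, norm_smul, χ.norm_val, one_mul]

/-- Some operators of a quasi-compact representation are arbitrarily close to compact ones. -/
theorem IsQuasiCompact.exists_norm_sub_lt {T : OperatorRep S E} (h : IsQuasiCompact T)
    {δ : ℝ} (hδ : 0 < δ) :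
    ∃ (s : S) (K : E →L[ℂ] E), IsCompactOperator K ∧ ‖op T s - K‖ < δ := by
  obtain ⟨s, K, hK, hlt⟩ := h
  -- Compact operators form an ideal, so powers of `T_s - K` are compact perturbations of powers of
  -- `T_s`.
  have key : ∀ n : ℕ, ∃ K' : E →L[ℂ] E, IsCompactOperator K' ∧
      op T s ^ (n + 1) - K' = (op T s - K) ^ (n + 1) := by
    intro n
    induction n with
    | zero => exact ⟨K, hK, by simp⟩
    | succ n ih =>
      obtain ⟨K', hK', he⟩ := ih
      have h1 : IsCompactOperator (K' * (op T s - K) : E →L[ℂ] E) := hK'.comp_clm _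
      have h2 : IsCompactOperator (op T s ^ (n + 1) * K : E →L[ℂ] E) := hK.clm_comp (op T s ^ (n + 1))
      refine ⟨K' * (op T s - K) + op T s ^ (n + 1) * K, h1.add h2, ?_⟩
      rw [pow_succ _ (n + 1), pow_succ _ (n + 1), ← he]
      noncomm_ring
  obtain ⟨n, hn⟩ := exists_pow_lt_of_lt_one hδ hlt
  obtain ⟨K', hK', he⟩ := key n
  refine ⟨(n + 1) • s, K', hK', ?_⟩
  rw [op_nsmul, he]
  calc ‖(op T s - K) ^ (n + 1)‖ ≤ ‖op T s - K‖ ^ (n + 1) := norm_pow_le' _ n.succ_pos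
    _ ≤ ‖op T s - K‖ ^ n := pow_le_pow_of_le_one (norm_nonneg _) hlt.le n.le_succ
    _ < δ := hn

/-- For compact `K`, the map `R ↦ K R K` sends ultrafilters of bounded sets of operators to Cauchy
filters. -/
theorem exists_mem_norm_compact_mul_mul_lt {K : E →L[ℂ] E} (hK : IsCompactOperator K) {C : ℝ}
    (V : Ultrafilter (E →L[ℂ] E)) (hV : Metric.closedBall 0 C ∈ V) {ε : ℝ} (hε : 0 < ε) :
    ∃ t ∈ V, ∀ R ∈ t, ∀ R' ∈ t, ‖K * (R - R') * K‖ ≤ ε := by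
  have hlim : ∀ x : E, ∃ y, Tendsto (fun R : E →L[ℂ] E => K (R x)) V (𝓝 y) := by
    intro x
    have hc := hK.isCompact_closure_image_closedBall (𝕜₁ := ℂ) (C * ‖x‖)
    obtain ⟨y, -, hy⟩ := hc.ultrafilter_le_nhds (V.map fun R : E →L[ℂ] E => K (R x)) (by
      rw [le_principal_iff]
      change ∀ᶠ R : E →L[ℂ] E in V, K (R x) ∈ closure (K '' Metric.closedBall 0 (C * ‖x‖))
      filter_upwards [hV] with R hR
      refine subset_closure ⟨R x, ?_, rfl⟩
      rw [mem_closedBall_zero_iff] at hR ⊢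
      exact R.le_of_opNorm_le hR x)
    exact ⟨y, hy⟩
  choose g hg using hlim
  -- Replacing `K x` by a point of a finite `δ`-net costs `2 * ‖K‖ * |C| * δ`; the variation of `K
  -- R` at net points costs `2 * δ`.
  obtain ⟨δ, hδ, hδε⟩ : ∃ δ > 0, δ * (2 * ‖K‖ * |C| + 2) ≤ ε :=
    ⟨ε / (2 * ‖K‖ * |C| + 2), by positivity, by rw [div_mul_cancel₀]; positivity⟩
  have htb := (hK.isCompact_closure_image_closedBall (𝕜₁ := ℂ) 1).totallyBounded
  obtain ⟨Y, hYfin, hY⟩ := Metric.totallyBounded_iff.1 htb δ hδ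
  have hev : ∀ᶠ R : E →L[ℂ] E in V, ∀ y ∈ Y, dist (K (R y)) (g y) < δ :=
    (eventually_all_finite hYfin).2 fun y _ => (hg y).eventually (Metric.ball_mem_nhds _ hδ)
  refine ⟨_, Filter.inter_mem hev hV, ?_⟩
  rintro R ⟨hR, hRC⟩ R' ⟨hR', hRC'⟩
  rw [mem_closedBall_zero_iff] at hRC hRC'
  refine ContinuousLinearMap.opNorm_le_of_unit_norm (𝕜 := ℂ) hε.le fun x hx => ?_
  have hKx : K x ∈ closure (K '' Metric.closedBall 0 1) :=
    subset_closure ⟨x, by simp [hx], rfl⟩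
  obtain ⟨y, hyY, hy⟩ := Set.mem_iUnion₂.1 (hY hKx)
  have e : (K * (R - R') * K) x = K ((R - R') (K x - y)) + (K (R y) - K (R' y)) := by
    simp only [mul_apply_eq_comp, sub_apply, map_sub]
    abel
  have h1 : ‖K ((R - R') (K x - y))‖ ≤ ‖K‖ * (2 * |C| * δ) := by
    refine K.le_opNorm_of_le (ContinuousLinearMap.le_of_opNorm_le_of_le _ ?_ ?_)
    · linarith [norm_sub_le R R', le_abs_self C]
    · exact (mem_ball_iff_norm.1 hy).le
  have h2 : ‖K (R y) - K (R' y)‖ ≤ 2 * δ := by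
    rw [← dist_eq_norm]
    linarith [dist_triangle_right (K (R y)) (K (R' y)) (g y), hR y hyY, hR' y hyY]
  rw [e]
  refine (norm_add_le _ _).trans (le_trans ?_ hδε)
  linarith

/-! ### The convex hull as a bounded commutative semigroup -/

theorem op_mem_hull (T : OperatorRep S E) (s : S) : op T s ∈ convexHull ℝ (Set.range (op T)) :=
  subset_convexHull ℝ _ ⟨s, rfl⟩

theorem mul_mem_hull (T : OperatorRep S E) {A B : E →L[ℂ] E}
    (hA : A ∈ convexHull ℝ (Set.range (op T))) (hB : B ∈ convexHull ℝ (Set.range (op T))) :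
    A * B ∈ convexHull ℝ (Set.range (op T)) := by
  have h1 : ∀ s, ∀ B ∈ convexHull ℝ (Set.range (op T)),
      op T s * B ∈ convexHull ℝ (Set.range (op T)) := by
    intro s
    refine fun B hB => convexHull_min (t := (LinearMap.mulLeft ℝ (op T s)) ⁻¹'
      convexHull ℝ (Set.range (op T))) ?_ ((convex_convexHull ℝ _).linear_preimage _) hB
    rintro _ ⟨t, rfl⟩
    simpa [← op_add] using op_mem_hull T (s + t)
  refine convexHull_min (t := (LinearMap.mulRight ℝ B) ⁻¹'
      convexHull ℝ (Set.range (op T))) ?_ ((convex_convexHull ℝ _).linear_preimage _) hA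
  rintro _ ⟨t, rfl⟩
  exact h1 t B hB

theorem commute_of_mem_hull (T : OperatorRep S E) {A B : E →L[ℂ] E}
    (hA : A ∈ convexHull ℝ (Set.range (op T))) (hB : B ∈ convexHull ℝ (Set.range (op T))) :
    A * B = B * A := by
  have key : ∀ B : E →L[ℂ] E, (∀ s, op T s * B = B * op T s) →
      ∀ A ∈ convexHull ℝ (Set.range (op T)), A * B = B * A := by
    intro B h A hA
    have := convexHull_min (t := (LinearMap.ker (LinearMap.mulRight ℝ B - LinearMap.mulLeft ℝ B) :
      Set (E →L[ℂ] E))) ?_ (Submodule.convex _) hA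
    · simpa [sub_eq_zero] using this
    · rintro _ ⟨s, rfl⟩
      simpa [sub_eq_zero] using h s
  refine key B (fun s => (key _ (fun t => ?_) B hB).symm) A hA
  rw [← op_add, ← op_add, add_comm]

theorem norm_le_of_mem_hull {T : OperatorRep S E} {C : ℝ} (hC : ∀ s, ‖op T s‖ ≤ C)
    {A : E →L[ℂ] E} (hA : A ∈ convexHull ℝ (Set.range (op T))) : ‖A‖ ≤ C := by
  have := convexHull_min (t := Metric.closedBall (0 : E →L[ℂ] E) C) ?_
    (convex_closedBall _ _) hA
  · simpa using this
  · rintro _ ⟨s, rfl⟩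
    simpa using hC s

/-- The hull contains elements almost fixed by a given operator of the representation. -/
theorem exists_mem_hull_norm_sub_le {T : OperatorRep S E} {C : ℝ} (hC : ∀ s, ‖op T s‖ ≤ C)
    (s : S) {ε : ℝ} (hε : 0 < ε) :
    ∃ A ∈ convexHull ℝ (Set.range (op T)), ‖(1 - op T s) * A‖ ≤ ε := by
  -- The geometric sum telescopes to `1 - T_s ^ (n + 1)`, of norm at most `2 * C`.
  obtain ⟨n, hn⟩ := exists_nat_gt (2 * C / ε)
  have hn0 : (0 : ℝ) < n + 1 := by positivity
  refine ⟨((n : ℝ) + 1)⁻¹ • ∑ k ∈ Finset.range (n + 1), op T s ^ k, ?_, ?_⟩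
  · rw [Finset.smul_sum]
    refine (convex_convexHull ℝ _).sum_mem (fun _ _ => by positivity) ?_ fun k _ => ?_
    · simp [hn0.ne']
    · rw [← op_nsmul]
      exact op_mem_hull T _
  · rw [mul_smul_comm, mul_neg_geom_sum, norm_smul, ← op_nsmul, ← op_zero T, norm_inv,
      Real.norm_of_nonneg hn0.le, inv_mul_le_iff₀ hn0]
    rw [div_lt_iff₀ hε] at hn
    have := norm_sub_le (op T 0) (op T ((n + 1) • s))
    linarith [hC 0, hC ((n + 1) • s)]

/-- An ultrafilter containing all translates `A H` of the convex hull `H` of the representation. -/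
theorem exists_ultrafilter_hull (T : OperatorRep S E) :
    ∃ U : Ultrafilter (E →L[ℂ] E), ∀ A ∈ convexHull ℝ (Set.range (op T)),
      (fun R => A * R) '' convexHull ℝ (Set.range (op T)) ∈ U := by
  set H := convexHull ℝ (Set.range (op T)) with hH
  have : Nonempty H := ⟨⟨_, op_mem_hull T 0⟩⟩
  have hne : NeBot (⨅ A : H, 𝓟 ((fun R => (A : E →L[ℂ] E) * R) '' H)) := by
    refine iInf_neBot_of_directed' ?_ fun A => ?_
    · intro A B
      refine ⟨⟨A * B, mul_mem_hull T A.2 B.2⟩, ?_, ?_⟩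
      · refine principal_mono.2 ?_
        rintro _ ⟨R, hR, rfl⟩
        exact ⟨B * R, mul_mem_hull T B.2 hR, (mul_assoc _ _ _).symm⟩
      · refine principal_mono.2 ?_
        rintro _ ⟨R, hR, rfl⟩
        refine ⟨A * R, mul_mem_hull T A.2 hR, ?_⟩
        simp only [commute_of_mem_hull T A.2 B.2, mul_assoc]
    · exact principal_neBot_iff.2 ⟨_, A, A.2, rfl⟩
  obtain ⟨U, hU⟩ := Ultrafilter.exists_le (⨅ A : H, 𝓟 ((fun R => (A : E →L[ℂ] E) * R) '' H))
  exact ⟨U, fun A hA => hU (mem_iInf_of_mem ⟨A, hA⟩ (mem_principal_self _))⟩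

/-- An ultrafilter containing all translates of the hull of a bounded quasi-compact representation
is a Cauchy filter. -/
theorem cauchy_of_translates_mem {T : OperatorRep S E} {C : ℝ} (hC : ∀ s, ‖op T s‖ ≤ C)
    (hqc : IsQuasiCompact T) (U : Ultrafilter (E →L[ℂ] E))
    (hU : ∀ A ∈ convexHull ℝ (Set.range (op T)),
      (fun R => A * R) '' convexHull ℝ (Set.range (op T)) ∈ U) :
    Cauchy (U : Filter (E →L[ℂ] E)) := by
  have hC0 : 0 ≤ C := (norm_nonneg _).trans (hC 0)
  refine Metric.cauchy_iff.2 ⟨U.neBot, fun ε hε => ?_⟩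
  -- `δ ≤ 1` gives `‖K‖ ≤ C + 1`; the product in the last bound is the sum of `h1` and `h2` below.
  obtain ⟨δ, hδ, hδ1, hδε⟩ : ∃ δ > 0, δ ≤ 1 ∧ δ * (2 * C * (2 * C + 1)) ≤ ε / 3 := by
    have hp : 0 < 2 * C * (2 * C + 1) + 1 := by positivity
    refine ⟨min 1 (ε / 3 / (2 * C * (2 * C + 1) + 1)), by positivity, min_le_left _ _, ?_⟩
    have h := (le_div_iff₀ hp).1 (min_le_right 1 (ε / 3 / (2 * C * (2 * C + 1) + 1)))
    refine le_trans (mul_le_mul_of_nonneg_left ?_ (by positivity)) h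
    linarith
  obtain ⟨s, K, hK, hsK⟩ := hqc.exists_norm_sub_lt hδ
  set Q := op T s with hQ
  -- By commutativity `Q H Q = Q² H`, a translate of `H`; hence `U` lifts to an ultrafilter `V` on
  -- `H`.
  have hmem : (fun R => Q * R * Q) '' convexHull ℝ (Set.range (op T)) ∈ U := by
    refine Filter.mem_of_superset (hU (Q * Q)
      (mul_mem_hull T (op_mem_hull T s) (op_mem_hull T s))) ?_
    rintro _ ⟨R, hR, rfl⟩
    refine ⟨R, hR, ?_⟩
    simp only [mul_assoc, commute_of_mem_hull T hR (op_mem_hull T s), hQ]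
  obtain ⟨V, hVH, hVU⟩ : ∃ V : Ultrafilter (E →L[ℂ] E),
      convexHull ℝ (Set.range (op T)) ∈ V ∧ V.map (fun R => Q * R * Q) = U :=
    ⟨Ultrafilter.ofComapInfPrincipal hmem, Ultrafilter.ofComapInfPrincipal_mem hmem,
      Ultrafilter.ofComapInfPrincipal_eq_of_map hmem⟩
  obtain ⟨t, htV, ht⟩ := exists_mem_norm_compact_mul_mul_lt (C := C) hK V
    (Filter.mem_of_superset hVH fun R hR => by simpa using norm_le_of_mem_hull hC hR)
    (ε := ε / 3) (by positivity)
  refine ⟨(fun R => Q * R * Q) '' (t ∩ convexHull ℝ (Set.range (op T))), ?_, ?_⟩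
  · rw [← hVU]
    exact Filter.image_mem_map (Filter.inter_mem htV hVH)
  rintro _ ⟨R, ⟨hRt, hR⟩, rfl⟩ _ ⟨R', ⟨hRt', hR'⟩, rfl⟩
  have hD : ‖R - R'‖ ≤ 2 * C := by
    linarith [norm_sub_le R R', norm_le_of_mem_hull hC hR, norm_le_of_mem_hull hC hR']
  have hQC : ‖Q‖ ≤ C := hC s
  have hKC : ‖K‖ ≤ C + 1 := by
    have := norm_sub_le Q (Q - K)
    rw [sub_sub_cancel] at this
    linarith
  have e : Q * R * Q - Q * R' * Q =
      K * (R - R') * K + (Q - K) * (R - R') * Q + K * (R - R') * (Q - K) := by noncomm_ring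
  have h1 : ‖(Q - K) * (R - R') * Q‖ ≤ δ * (2 * C) * C :=
    (norm_mul_le _ _).trans (mul_le_mul ((norm_mul_le _ _).trans
      (mul_le_mul hsK.le hD (norm_nonneg _) hδ.le)) hQC (norm_nonneg _) (by positivity))
  have h2 : ‖K * (R - R') * (Q - K)‖ ≤ (C + 1) * (2 * C) * δ :=
    (norm_mul_le _ _).trans (mul_le_mul ((norm_mul_le _ _).trans
      (mul_le_mul hKC hD (norm_nonneg _) (by positivity))) hsK.le (norm_nonneg _) (by positivity))
  simp only [dist_eq_norm]
  rw [e]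
  have h3 := norm_add₃_le (a := K * (R - R') * K) (b := (Q - K) * (R - R') * Q)
    (c := K * (R - R') * (Q - K))
  have h4 := ht R hRt R' hRt'
  nlinarith

/-- Bounded quasi-compact representations are uniformly mean ergodic. -/
theorem IsQuasiCompact.isUniformlyMeanErgodic [CompleteSpace E] {T : OperatorRep S E}
    (hqc : IsQuasiCompact T) (hb : IsBounded T) : IsUniformlyMeanErgodic T := by
  refine ⟨hb, ?_⟩
  obtain ⟨C, hC⟩ := hb
  have hC0 : 0 ≤ C := (norm_nonneg _).trans (hC 0)
  obtain ⟨U, hU⟩ := exists_ultrafilter_hull T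
  obtain ⟨P, hP⟩ := CompleteSpace.complete (cauchy_of_translates_mem hC hqc U hU)
  have hUH : convexHull ℝ (Set.range (op T)) ∈ U := by
    simpa [op_zero] using hU _ (op_mem_hull T 0)
  have hPC : P ∈ closedConvexHullRange T := mem_closure_iff_ultrafilter.2 ⟨U, hUH, hP⟩
  have hfix : ∀ s, op T s * P = P := by
    intro s
    have h0 : ‖(1 - op T s) * P‖ ≤ 0 := by
      refine le_of_forall_pos_le_add fun ε hε => ?_
      -- `C + 1` absorbs the factor `‖R‖ ≤ C` and stays positive when `C = 0`.
      obtain ⟨A, hA, hAε⟩ := exists_mem_hull_norm_sub_le hC s (ε := ε / (C + 1)) (by positivity)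
      have hcont : Continuous fun R : E →L[ℂ] E => ‖(1 - op T s) * R‖ := by fun_prop
      refine le_of_tendsto ((hcont.tendsto P).mono_left hP) ?_
      filter_upwards [hU A hA]
      rintro _ ⟨R, hR, rfl⟩
      rw [← mul_assoc, zero_add]
      refine (norm_mul_le _ _).trans ((mul_le_mul hAε (norm_le_of_mem_hull hC hR)
        (norm_nonneg _) (by positivity)).trans ?_)
      rw [div_mul_eq_mul_div, div_le_iff₀ (by positivity)]
      nlinarith
    have h1 : (1 - op T s) * P = 0 := norm_le_zero_iff.1 h0
    rw [sub_mul, one_mul, sub_eq_zero] at h1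
    exact h1.symm
  have hfix' : ∀ R ∈ closedConvexHullRange T, R * P = P := by
    intro R hR
    refine closure_minimal (t := {R | R * P = P}) (convexHull_min ?_ ?_)
      (isClosed_eq (by fun_prop) continuous_const) hR
    · rintro _ ⟨s, rfl⟩
      exact hfix s
    · intro A hA B hB a b _ _ hab
      simp only [Set.mem_ofPred_eq] at hA hB ⊢
      rw [add_mul, smul_mul_assoc, smul_mul_assoc, hA, hB, ← add_smul, hab, one_smul]
  have hcomm : ∀ R ∈ closedConvexHullRange T, ∀ R' ∈ closedConvexHullRange T,
      R * R' = R' * R := by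
    intro R hR R' hR'
    exact Set.EqOn.of_subset_closure
      (s := convexHull ℝ (Set.range (op T)) ×ˢ convexHull ℝ (Set.range (op T)))
      (t := closedConvexHullRange T ×ˢ closedConvexHullRange T)
      (f := fun p : (E →L[ℂ] E) × (E →L[ℂ] E) => p.1 * p.2) (g := fun p => p.2 * p.1)
      (fun p hp => commute_of_mem_hull T hp.1 hp.2) (by fun_prop) (by fun_prop)
      (Set.prod_mono subset_closure subset_closure) closure_prod_eq.ge
      (show (R, R') ∈ _ from ⟨hR, hR'⟩)
  exact ⟨P, hPC, fun R hR => ⟨hfix' R hR, (hcomm P hPC R hR).trans (hfix' R hR)⟩⟩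

/-! ### Finite-dimensional eigenspaces -/

theorem mem_eigenspace_iff {χ : UnitaryCharacter S} {T : OperatorRep S E} {x : E} :
    x ∈ eigenspace χ T ↔ ∀ s, op T s x = χ.val s • x := by
  simp [eigenspace, sub_eq_zero, eq_comm (a := op T _ x)]

/-- A closed subspace on which a compact operator is bounded below is
finite-dimensional. -/
theorem finiteDimensional_of_isCompactOperator [CompleteSpace E] {K : E →L[ℂ] E}
    (hK : IsCompactOperator K) {F : Submodule ℂ E} (hF : IsClosed (F : Set E)) {c : ℝ}
    (hc : 0 < c) (h : ∀ x ∈ F, c * ‖x‖ ≤ ‖K x‖) : FiniteDimensional ℂ F := by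
  have : CompleteSpace F := hF.completeSpace_coe
  let f : F →L[ℂ] E := K.comp F.subtypeL
  have hcf : ∀ x : F, ‖x‖ ≤ (⟨c⁻¹, by positivity⟩ : NNReal) * ‖f x‖ := fun x => by
    change ‖x‖ ≤ c⁻¹ * ‖f x‖
    rw [← div_eq_inv_mul, le_div_iff₀ hc, mul_comm]
    exact h x x.2
  -- Being bounded below makes `f` a closed embedding, so preimages of compact sets are compact; one
  -- of them contains the unit ball of `F`.
  have hemb := (f.antilipschitz_of_bound hcf).isClosedEmbedding f.uniformContinuous
  have hf : IsCompactOperator f := hK.comp_clm F.subtypeL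
  have hcpt := hf.isCompact_closure_image_closedBall (𝕜₁ := ℂ) 1
  refine FiniteDimensional.of_isCompact_closedBall₀ ℂ one_pos
    ((hemb.isCompact_preimage hcpt).of_isClosed_subset Metric.isClosed_closedBall fun x hx => ?_)
  exact subset_closure ⟨x, hx, rfl⟩

/-- `T_s` is isometric on the eigenspace, so `K` is bounded below there by `1 - ‖T_s - K‖ > 0`. -/
theorem IsQuasiCompact.finiteDimensional_eigenspace [CompleteSpace E] {T : OperatorRep S E}
    (hqc : IsQuasiCompact T) (χ : UnitaryCharacter S) :
    FiniteDimensional ℂ (eigenspace χ T) := by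
  obtain ⟨s, K, hK, hlt⟩ := hqc
  refine finiteDimensional_of_isCompactOperator hK ?_ (sub_pos.2 hlt) fun x hx => ?_
  · have : (eigenspace χ T : Set E) = ⋂ s, {x | op T s x = χ.val s • x} := by
      ext x
      simp [mem_eigenspace_iff]
    rw [this]
    exact isClosed_iInter fun s => isClosed_eq (by fun_prop) (by fun_prop)
  · have h1 := (op T s - K).le_opNorm x
    have h2 := norm_sub_norm_le (op T s x) (K x)
    rw [← sub_apply, mem_eigenspace_iff.1 hx s, norm_smul, χ.norm_val,
      one_mul] at h2
    linarith

end SemigroupRep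

theorem corollary3p12 {S : Type*} [AddCommMonoid S]
    {E : Type*} [NormedAddCommGroup E] [NormedSpace ℂ E] [CompleteSpace E]
    (T : SemigroupRep.OperatorRep S E)
    (hbdd : SemigroupRep.IsBounded T) (hqc : SemigroupRep.IsQuasiCompact T) :
    SemigroupRep.IsTotallyUniformlyMeanErgodic T ∧
      ∀ χ : SemigroupRep.UnitaryCharacter S,
        FiniteDimensional ℂ (SemigroupRep.eigenspace χ T) :=
  ⟨⟨hbdd, fun χ => (hqc.rotate χ).isUniformlyMeanErgodic (hbdd.rotate χ)⟩,
    fun χ => hqc.finiteDimensional_eigenspace χ⟩
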